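/- Corollary 4.5 (Hopf's formula for Hom-Lie algebras). Let $\mathbb F$ be a field. A Hom-Lie algebra $(L,\alpha_L)$ over $\mathbb F$ is an $\mathbb F$-vector space $L$ with a bilinear product $[\cdot,\cdot]$ and a linear map $\alpha_L:L\to L$ such that $[x,x]=0$ (if $\operatorname{char}\mathbb F\neq 2$ this is the same as $[x,y]=-[y,x]$), $\alpha_L([x,y])=[\alpha_L(x),\alpha_L(y)]$ and $$[\alpha_L(x),[y,z]]+[\alpha_L(y),[z,x]]+[\alpha_L(z),[x,y]]=0$$ for all $x,y,z\in L$. Homomorphisms of Hom-Lie algebras are the linear maps that preserve the products and commute with the maps $\alpha$. A Hom-vector space is a vector space with a linear endomorphism, and an isomorphism of Hom-vector spaces is a linear isomorphism that commutes with the endomorphisms. The second homology (with trivial coefficients) of $(L,\alpha_L)$ is the Hom-vector space $H_2^\alpha(L)=\ker d_2/\operatorname{Im}d_3$ with the endomorphism induced by $\alpha_L\wedge\alpha_L$, where $d_3:\bigwedge^3L\to\bigwedge^2L$ and $d_2:\bigwedge^2L\to L$ are the linear maps $$d_3(x\wedge y\wedge z)=-[x,y]\wedge\alpha_L(z)+[x,z]\wedge\alpha_L(y)-[y,z]\wedge\alpha_L(x),\qquad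 d_2(x\wedge y)=-[x,y].$$ For a set $X$ with a map $\alpha_X:X\to X$, the free Hom-Lie algebra on $(X,\alpha_X)$ is $A_X/I$, where $A_X$ is the free (non-unital) non-associative $\mathbb F$-algebra on $X$, $\alpha_A$ is the endomorphism of $A_X$ induced by $\alpha_X$, $I$ is the two-sided ideal generated by the elements $aa$, $ab+ba$ and $\alpha_A(a)(bc)+\alpha_A(b)(ca)+\alpha_A(c)(ab)$ for $a,b,c\in A_X$, and the endomorphism of $A_X/I$ is the one induced by $\alpha_A$. A free presentation of $(L,\alpha_L)$ is a surjective homomorphism $\rho:(F,\alpha_F)\twoheadrightarrow(L,\alpha_L)$ where $(F,\alpha_F)$ is isomorphic to the free Hom-Lie algebra on some $(X,\alpha_X)$; put $R=\ker\rho$. For ideals $H,K$ of $F$ let $[H,K]$ be the linear span of all $[h,k]$ with $h\in H$, $k\in K$. Then every Hom-Lie algebra $(L,\alpha_L)$ has a free presentation, and for every free presentation $R\rightarrowtail F\twoheadrightarrow L$ there is an isomorphism of Hom-vector spaces $$H_2^\alpha(L)\;\cong\;\mathcal M(L,\alpha_L)=\frac{R\cap[F,F]}{[F,R]},$$ where the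 endomorphism of the right-hand side is the one induced by $\alpha_F$. -/

import Mathlib

universe u v w x

/-- A (multiplicative) Hom-Lie algebra over a field `𝕜`: a vector space `L` with a bilinear
alternating product and a linear product-preserving endomorphism `α` satisfying the Hom-Jacobi
identity. Skew-symmetry is imposed in the form `[x, x] = 0`; when `2 ≠ 0` in `𝕜` this is equivalent
to `[x, y] = -[y, x]` (see `HomLieAlgebra.bracket_skew` and `HomLieAlgebra.ofSkew`), and in
characteristic two it is what makes the Chevalley-Eilenberg differential on exterior powers
well defined. -/
class HomLieAlgebra (𝕜 : Type u) (L : Type v) [Field 𝕜] [AddCommGroup L] [Module 𝕜 L] where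
  /-- the product `[x, y]` -/
  bracket (𝕜) : L →ₗ[𝕜] L →ₗ[𝕜] L
  /-- the companion endomorphism -/
  α (𝕜) : L →ₗ[𝕜] L
  bracket_self : ∀ x, bracket x x = 0
  hom_jacobi : ∀ x y z,
    bracket (α x) (bracket y z) + bracket (α y) (bracket z x) + bracket (α z) (bracket x y) = 0
  map_bracket : ∀ x y, α (bracket x y) = bracket (α x) (α y)

namespace HomLieAlgebra

section Basic

variable (𝕜 : Type u) [Field 𝕜] {L : Type v} [AddCommGroup L] [Module 𝕜 L]

theorem bracket_skew [HomLieAlgebra 𝕜 L] (x y : L) : bracket 𝕜 x y = -bracket 𝕜 y x := by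
  have h := bracket_self (𝕜 := 𝕜) (x + y)
  simp only [map_add, LinearMap.add_apply, bracket_self, zero_add, add_zero] at h
  exact eq_neg_of_add_eq_zero_right h

/-- Away from characteristic two, a skew-symmetric product is enough. -/
abbrev ofSkew (h2 : (2 : 𝕜) ≠ 0) (b : L →ₗ[𝕜] L →ₗ[𝕜] L) (a : L →ₗ[𝕜] L)
    (skew : ∀ x y, b x y = -b y x)
    (jac : ∀ x y z, b (a x) (b y z) + b (a y) (b z x) + b (a z) (b x y) = 0)
    (mul : ∀ x y, a (b x y) = b (a x) (a y)) : HomLieAlgebra 𝕜 L where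
  bracket := b
  α := a
  bracket_self x := by
    have h : (2 : 𝕜) • b x x = 0 := by
      rw [two_smul]; nth_rewrite 1 [skew x x]; exact neg_add_cancel _
    exact (smul_eq_zero.1 h).resolve_left h2
  hom_jacobi := jac
  map_bracket := mul

/-- The commutator `[H, K]`: the subspace spanned by the elements `[h, k]`, `h ∈ H`, `k ∈ K`. -/
def commutator [HomLieAlgebra 𝕜 L] (H K : Submodule 𝕜 L) : Submodule 𝕜 L :=
  Submodule.span 𝕜 {x | ∃ h ∈ H, ∃ k ∈ K, bracket 𝕜 h k = x}

end Basic

/-- Homomorphisms of Hom-Lie algebras. -/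
structure Hom (𝕜 : Type u) [Field 𝕜] (L : Type v) [AddCommGroup L] [Module 𝕜 L]
    [HomLieAlgebra 𝕜 L] (L' : Type w) [AddCommGroup L'] [Module 𝕜 L'] [HomLieAlgebra 𝕜 L']
    extends L →ₗ[𝕜] L' where
  map_bracket' : ∀ x y, toFun (bracket 𝕜 x y) = bracket 𝕜 (toFun x) (toFun y)
  map_α' : ∀ x, toFun (α 𝕜 x) = α 𝕜 (toFun x)

/-! ### Free Hom-Lie algebras on Hom-sets -/

section Free

variable (𝕜 : Type u) [Field 𝕜] {X : Type w} (αX : X → X)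

/-- The endomorphism of the free non-associative algebra on `X` (the algebra of the free magma
on `X`) induced by `αX`. -/
noncomputable def freeα :
    FreeNonUnitalNonAssocAlgebra 𝕜 X →ₙₐ[𝕜] FreeNonUnitalNonAssocAlgebra 𝕜 X :=
  FreeNonUnitalNonAssocAlgebra.lift 𝕜 (fun x => FreeNonUnitalNonAssocAlgebra.of 𝕜 (αX x))

/-- `I` is a two-sided ideal containing `aa`, `ab + ba` and `α(a)(bc) + α(b)(ca) + α(c)(ab)`.
(The elements `aa` are redundant unless `𝕜` has characteristic two.) -/
structure IsHomLieIdeal (I : Submodule 𝕜 (FreeNonUnitalNonAssocAlgebra 𝕜 X)) : Prop where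
  self_mem : ∀ a, a * a ∈ I
  skew_mem : ∀ a b, a * b + b * a ∈ I
  jacobi_mem : ∀ a b c,
    freeα 𝕜 αX a * (b * c) + freeα 𝕜 αX b * (c * a) + freeα 𝕜 αX c * (a * b) ∈ I
  mul_left_mem : ∀ a, ∀ x ∈ I, a * x ∈ I
  mul_right_mem : ∀ a, ∀ x ∈ I, x * a ∈ I

/-- The smallest two-sided ideal containing the defining relations of Hom-Lie algebras. -/
noncomputable def freeIdeal : Submodule 𝕜 (FreeNonUnitalNonAssocAlgebra 𝕜 X) :=
  sInf {I | IsHomLieIdeal 𝕜 αX I}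

theorem freeIdeal_le {I : Submodule 𝕜 (FreeNonUnitalNonAssocAlgebra 𝕜 X)}
    (h : IsHomLieIdeal 𝕜 αX I) : freeIdeal 𝕜 αX ≤ I :=
  sInf_le h

theorem isHomLieIdeal_freeIdeal : IsHomLieIdeal 𝕜 αX (freeIdeal 𝕜 αX) where
  self_mem a := by
    rw [freeIdeal, Submodule.mem_sInf]; exact fun I hI => hI.self_mem a
  skew_mem a b := by
    rw [freeIdeal, Submodule.mem_sInf]; exact fun I hI => hI.skew_mem a b
  jacobi_mem a b c := by
    rw [freeIdeal, Submodule.mem_sInf]; exact fun I hI => hI.jacobi_mem a b c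
  mul_left_mem a x hx := by
    rw [freeIdeal, Submodule.mem_sInf] at hx ⊢
    exact fun I hI => hI.mul_left_mem a x (hx I hI)
  mul_right_mem a x hx := by
    rw [freeIdeal, Submodule.mem_sInf] at hx ⊢
    exact fun I hI => hI.mul_right_mem a x (hx I hI)

theorem freeIdeal_le_comap :
    freeIdeal 𝕜 αX ≤ (freeIdeal 𝕜 αX).comap (freeα 𝕜 αX : _ →ₗ[𝕜] _) := by
  have h := isHomLieIdeal_freeIdeal 𝕜 αX
  refine freeIdeal_le 𝕜 αX ⟨fun a => ?_, fun a b => ?_, fun a b c => ?_, fun a x hx => ?_,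
    fun a x hx => ?_⟩
  · simpa using h.self_mem (freeα 𝕜 αX a)
  · simpa using h.skew_mem (freeα 𝕜 αX a) (freeα 𝕜 αX b)
  · simpa using h.jacobi_mem (freeα 𝕜 αX a) (freeα 𝕜 αX b) (freeα 𝕜 αX c)
  · simpa using h.mul_left_mem (freeα 𝕜 αX a) _ hx
  · simpa using h.mul_right_mem (freeα 𝕜 αX a) _ hx

/-- The free Hom-Lie algebra on the Hom-set `(X, αX)`: the free non-associative algebra on `X`
modulo the ideal of Hom-Lie relations. -/
abbrev Free : Type max u w :=
  FreeNonUnitalNonAssocAlgebra 𝕜 X ⧸ freeIdeal 𝕜 αX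

/-- The product of the free Hom-Lie algebra, induced by the product of the free algebra. -/
noncomputable def freeBracket : Free 𝕜 αX →ₗ[𝕜] Free 𝕜 αX →ₗ[𝕜] Free 𝕜 αX :=
  (freeIdeal 𝕜 αX).liftQ
    { toFun := fun a => (freeIdeal 𝕜 αX).mapQ (freeIdeal 𝕜 αX) (LinearMap.mulLeft 𝕜 a)
        (fun x hx => (isHomLieIdeal_freeIdeal 𝕜 αX).mul_left_mem a x hx)
      map_add' := fun a b => by
        refine LinearMap.ext fun y => ?_
        obtain ⟨x, rfl⟩ := Submodule.Quotient.mk_surjective _ y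
        exact congrArg Submodule.Quotient.mk (add_mul a b x)
      map_smul' := fun c a => by
        refine LinearMap.ext fun y => ?_
        obtain ⟨x, rfl⟩ := Submodule.Quotient.mk_surjective _ y
        exact congrArg Submodule.Quotient.mk (smul_mul_assoc c a x) }
    (fun a ha => by
      rw [LinearMap.mem_ker]
      refine LinearMap.ext fun y => ?_
      obtain ⟨x, rfl⟩ := Submodule.Quotient.mk_surjective _ y
      exact (Submodule.Quotient.mk_eq_zero _).2
        ((isHomLieIdeal_freeIdeal 𝕜 αX).mul_right_mem x a ha))

theorem freeBracket_mk (a b : FreeNonUnitalNonAssocAlgebra 𝕜 X) :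
    freeBracket 𝕜 αX (Submodule.Quotient.mk a) (Submodule.Quotient.mk b) =
      Submodule.Quotient.mk (a * b) := rfl

noncomputable instance : HomLieAlgebra 𝕜 (Free 𝕜 αX) where
  bracket := freeBracket 𝕜 αX
  α := (freeIdeal 𝕜 αX).mapQ (freeIdeal 𝕜 αX) (freeα 𝕜 αX : _ →ₗ[𝕜] _) (freeIdeal_le_comap 𝕜 αX)
  bracket_self x := by
    obtain ⟨a, rfl⟩ := Submodule.Quotient.mk_surjective _ x
    exact (Submodule.Quotient.mk_eq_zero _).2 ((isHomLieIdeal_freeIdeal 𝕜 αX).self_mem a)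
  hom_jacobi x y z := by
    obtain ⟨a, rfl⟩ := Submodule.Quotient.mk_surjective _ x
    obtain ⟨b, rfl⟩ := Submodule.Quotient.mk_surjective _ y
    obtain ⟨c, rfl⟩ := Submodule.Quotient.mk_surjective _ z
    exact (Submodule.Quotient.mk_eq_zero _).2 ((isHomLieIdeal_freeIdeal 𝕜 αX).jacobi_mem a b c)
  map_bracket x y := by
    obtain ⟨a, rfl⟩ := Submodule.Quotient.mk_surjective _ x
    obtain ⟨b, rfl⟩ := Submodule.Quotient.mk_surjective _ y
    exact congrArg Submodule.Quotient.mk (map_mul (freeα 𝕜 αX) a b)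

end Free

/-- A Hom-Lie algebra is free if it is isomorphic to the free Hom-Lie algebra on some Hom-set. -/
def IsFree (𝕜 : Type u) [Field 𝕜] (F : Type v) [AddCommGroup F] [Module 𝕜 F]
    [HomLieAlgebra 𝕜 F] : Prop :=
  ∃ (X : Type w) (αX : X → X) (e : Hom 𝕜 (Free 𝕜 αX) F), Function.Bijective e.toLinearMap

/-! ### The Schur multiplier of a presentation -/

section SchurMultiplier

variable {𝕜 : Type u} [Field 𝕜] {F : Type v} [AddCommGroup F] [Module 𝕜 F] [HomLieAlgebra 𝕜 F]
  {L : Type w} [AddCommGroup L] [Module 𝕜 L] [HomLieAlgebra 𝕜 L] (ρ : Hom 𝕜 F L)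

/-- The kernel `R` of `ρ : F → L`. -/
def Hom.ker : Submodule 𝕜 F := LinearMap.ker ρ.toLinearMap

/-- `R ∩ [F, F]`. -/
def Hom.kerInfCommutator : Submodule 𝕜 F := ρ.ker ⊓ commutator 𝕜 ⊤ ⊤

theorem Hom.mem_ker {x : F} : x ∈ ρ.ker ↔ ρ.toLinearMap x = 0 := Iff.rfl

theorem Hom.α_mem_ker {x : F} (hx : x ∈ ρ.ker) : α 𝕜 x ∈ ρ.ker := by
  rw [Hom.mem_ker] at hx ⊢
  have h : ρ.toLinearMap (α 𝕜 x) = α 𝕜 (ρ.toLinearMap x) := ρ.map_α' x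
  rw [h, hx, map_zero]

theorem commutator_le_comap {H K : Submodule 𝕜 F} (hH : ∀ x ∈ H, α 𝕜 x ∈ H)
    (hK : ∀ x ∈ K, α 𝕜 x ∈ K) : commutator 𝕜 H K ≤ (commutator 𝕜 H K).comap (α 𝕜) := by
  refine Submodule.span_le.2 ?_
  rintro _ ⟨h, hh, k, hk, rfl⟩
  exact Submodule.subset_span ⟨_, hH h hh, _, hK k hk, (map_bracket h k).symm⟩

theorem Hom.kerInfCommutator_le_comap :
    ρ.kerInfCommutator ≤ ρ.kerInfCommutator.comap (α 𝕜) := fun _ hx =>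
  ⟨ρ.α_mem_ker hx.1, commutator_le_comap (fun _ _ => Submodule.mem_top) (fun _ _ => Submodule.mem_top) hx.2⟩

theorem Hom.commutator_ker_le : commutator 𝕜 ⊤ ρ.ker ≤ ρ.kerInfCommutator := by
  refine Submodule.span_le.2 ?_
  rintro _ ⟨h, -, k, hk, rfl⟩
  refine ⟨?_, Submodule.subset_span ⟨h, trivial, k, trivial, rfl⟩⟩
  have e : ρ.toLinearMap (bracket 𝕜 h k) = bracket 𝕜 (ρ.toLinearMap h) (ρ.toLinearMap k) :=
    ρ.map_bracket' h k
  rw [Hom.mem_ker] at hk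
  change ρ.toLinearMap _ = 0
  rw [e, hk, map_zero]

/-- `(R ∩ [F, F]) / [F, R]`; by `Hom.commutator_ker_le` the space `[F, R]` is contained in
`R ∩ [F, F]`. -/
abbrev SchurMultiplier : Type v :=
  ρ.kerInfCommutator ⧸ (commutator 𝕜 ⊤ ρ.ker).submoduleOf ρ.kerInfCommutator

/-- The endomorphism of `(R ∩ [F, F]) / [F, R]` induced by the companion endomorphism of `F`. -/
def SchurMultiplier.α : SchurMultiplier ρ →ₗ[𝕜] SchurMultiplier ρ :=
  Submodule.mapQ _ _ ((HomLieAlgebra.α 𝕜).restrict ρ.kerInfCommutator_le_comap)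
    (fun _ hx => commutator_le_comap (fun _ _ => Submodule.mem_top) (fun _ hy => ρ.α_mem_ker hy) hx)

end SchurMultiplier

/-! ### The second homology with trivial coefficients -/

section Wedge

variable (𝕜 : Type u) [Field 𝕜] {L : Type v} [AddCommGroup L] [Module 𝕜 L]

/-- `x ∧ y`, bilinear in `x` and `y`. -/
noncomputable def wedge : L →ₗ[𝕜] L →ₗ[𝕜] ⋀[𝕜]^2 L :=
  have h0 : ∀ x y a : L, Function.update ![x, y] 0 a = ![a, y] := fun x y a => by
    ext i; fin_cases i <;> rfl
  have h1 : ∀ x y a : L, Function.update ![x, y] 1 a = ![x, a] := fun x y a => by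
    ext i; fin_cases i <;> rfl
  LinearMap.mk₂ 𝕜 (fun x y => exteriorPower.ιMulti 𝕜 2 ![x, y])
    (fun x x' y => by
      have h := (exteriorPower.ιMulti 𝕜 2 (M := L)).map_update_add ![x, y] 0 x x'
      rwa [h0, h0, h0] at h)
    (fun c x y => by
      have h := (exteriorPower.ιMulti 𝕜 2 (M := L)).map_update_smul ![x, y] 0 c x
      rwa [h0, h0] at h)
    (fun x y y' => by
      have h := (exteriorPower.ιMulti 𝕜 2 (M := L)).map_update_add ![x, y] 1 y y'
      rwa [h1, h1, h1] at h)
    (fun c x y => by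
      have h := (exteriorPower.ιMulti 𝕜 2 (M := L)).map_update_smul ![x, y] 1 c y
      rwa [h1, h1] at h)

theorem wedge_self (x : L) : wedge 𝕜 x x = 0 :=
  (exteriorPower.ιMulti 𝕜 2 (M := L)).map_eq_zero_of_eq ![x, x] (i := 0) (j := 1) rfl
    Fin.zero_ne_one

theorem wedge_skew (x y : L) : wedge 𝕜 x y = -wedge 𝕜 y x := by
  have h := wedge_self 𝕜 (x + y)
  simp only [map_add, LinearMap.add_apply, wedge_self, zero_add, add_zero] at h
  exact eq_neg_of_add_eq_zero_right h

end Wedge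

section SubQuotient

variable {𝕜 : Type*} [Field 𝕜] {A B C : Type*} [AddCommGroup A] [Module 𝕜 A] [AddCommGroup B]
  [Module 𝕜 B] [AddCommGroup C] [Module 𝕜 C] (f : B →ₗ[𝕜] C) (g : A →ₗ[𝕜] B)

/-- The homology `ker f / im g` of `A → B → C` (used only when `f ∘ g = 0`, so that `im g` is
contained in `ker f`). -/
abbrev SubQuotient : Type _ :=
  LinearMap.ker f ⧸ (LinearMap.range g).submoduleOf (LinearMap.ker f)

/-- The endomorphism of `ker f / im g` induced by an endomorphism `(a, b, c)` of `A → B → C`. -/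
def SubQuotient.map (a : A →ₗ[𝕜] A) (b : B →ₗ[𝕜] B) (c : C →ₗ[𝕜] C)
    (hf : ∀ t, f (b t) = c (f t)) (hg : ∀ t, b (g t) = g (a t)) :
    SubQuotient f g →ₗ[𝕜] SubQuotient f g :=
  have hker : ∀ t ∈ LinearMap.ker f, b t ∈ LinearMap.ker f := fun t ht => by
    rw [LinearMap.mem_ker] at ht ⊢
    rw [hf, ht, map_zero]
  Submodule.mapQ _ _ (b.restrict hker) (by
    rintro ⟨_, _⟩ ⟨s, hs⟩
    exact ⟨a s, by rw [← hg, hs]; rfl⟩)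

end SubQuotient

section Homology

variable (𝕜 : Type u) [Field 𝕜] (L : Type v) [AddCommGroup L] [Module 𝕜 L] [HomLieAlgebra 𝕜 L]

/-- The differential `d₂ : L ∧ L → L`, `d₂ (x ∧ y) = -[x, y]`, of the Hom-Chevalley-Eilenberg
complex with trivial coefficients `(𝕜, id)`, where `𝕜 ⊗ ⋀ⁿ L` is identified with `⋀ⁿ L`. -/
noncomputable def d₂ : ⋀[𝕜]^2 L →ₗ[𝕜] L :=
  exteriorPower.alternatingMapLinearEquiv
    { toFun := fun v => -bracket 𝕜 (v 0) (v 1)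
      map_update_add' := by
        intro inst m i x y
        obtain rfl : inst = instDecidableEqFin 2 := Subsingleton.elim _ _
        fin_cases i <;> simp <;> abel
      map_update_smul' := by
        intro inst m i c x
        obtain rfl : inst = instDecidableEqFin 2 := Subsingleton.elim _ _
        fin_cases i <;> simp
      map_eq_zero_of_eq' := by
        intro m i j hij hne
        fin_cases i <;> fin_cases j <;> simp_all [bracket_self] }

/-- The differential `d₃ : L ∧ L ∧ L → L ∧ L` of the same complex,
`d₃ (x ∧ y ∧ z) = -[x, y] ∧ α z + [x, z] ∧ α y - [y, z] ∧ α x`. -/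
noncomputable def d₃ : ⋀[𝕜]^3 L →ₗ[𝕜] ⋀[𝕜]^2 L :=
  exteriorPower.alternatingMapLinearEquiv
    { toFun := fun v => -wedge 𝕜 (bracket 𝕜 (v 0) (v 1)) (α 𝕜 (v 2))
        + wedge 𝕜 (bracket 𝕜 (v 0) (v 2)) (α 𝕜 (v 1))
        - wedge 𝕜 (bracket 𝕜 (v 1) (v 2)) (α 𝕜 (v 0))
      map_update_add' := by
        intro inst m i x y
        obtain rfl : inst = instDecidableEqFin 3 := Subsingleton.elim _ _
        obtain rfl | rfl | rfl : i = 0 ∨ i = 1 ∨ i = 2 := by revert i; decide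
        all_goals simp <;> abel
      map_update_smul' := by
        intro inst m i c x
        obtain rfl : inst = instDecidableEqFin 3 := Subsingleton.elim _ _
        obtain rfl | rfl | rfl : i = 0 ∨ i = 1 ∨ i = 2 := by revert i; decide
        all_goals simp [smul_add, smul_sub]
      map_eq_zero_of_eq' := by
        intro m i j hij hne
        have key : m 0 = m 1 ∨ m 0 = m 2 ∨ m 1 = m 2 := by
          fin_cases i <;> fin_cases j <;>
            first
            | exact absurd rfl hne
            | exact Or.inl hij
            | exact Or.inl hij.symm
            | exact Or.inr (Or.inl hij)
            | exact Or.inr (Or.inl hij.symm)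
            | exact Or.inr (Or.inr hij)
            | exact Or.inr (Or.inr hij.symm)
        rcases key with h | h | h
        · simp [h, bracket_self]
        · simp [h, bracket_self, bracket_skew 𝕜 (m 1) (m 2)]
        · simp [h, bracket_self] }

variable {L} in
theorem d₂_wedge (x y : L) : d₂ 𝕜 L (wedge 𝕜 x y) = -bracket 𝕜 x y := by
  simp [d₂, wedge]

variable {L} in
theorem d₃_ιMulti (x y z : L) : d₃ 𝕜 L (exteriorPower.ιMulti 𝕜 3 ![x, y, z]) =
    -wedge 𝕜 (bracket 𝕜 x y) (α 𝕜 z) + wedge 𝕜 (bracket 𝕜 x z) (α 𝕜 y)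
      - wedge 𝕜 (bracket 𝕜 y z) (α 𝕜 x) := by
  simp [d₃]

theorem d₂_comp_d₃ : d₂ 𝕜 L ∘ₗ d₃ 𝕜 L = 0 := by
  ext v
  have hv : v = ![v 0, v 1, v 2] := by ext i; fin_cases i <;> rfl
  have h := hom_jacobi (𝕜 := 𝕜) (v 0) (v 1) (v 2)
  rw [hv]
  simp only [LinearMap.compAlternatingMap_apply, LinearMap.comp_apply, d₃_ιMulti, map_add,
    map_sub, map_neg, d₂_wedge, LinearMap.zero_apply]
  rw [bracket_skew 𝕜 (α 𝕜 (v 0)), bracket_skew 𝕜 (α 𝕜 (v 1)), bracket_skew 𝕜 (α 𝕜 (v 2)),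
    bracket_skew 𝕜 (v 2) (v 0)] at h
  simp only [map_neg, LinearMap.neg_apply, neg_neg] at h ⊢
  rw [← neg_eq_zero, ← h]
  abel

theorem d₂_map_α (t : ⋀[𝕜]^2 L) : d₂ 𝕜 L (exteriorPower.map 2 (α 𝕜) t) = α 𝕜 (d₂ 𝕜 L t) := by
  refine LinearMap.congr_fun (f := d₂ 𝕜 L ∘ₗ exteriorPower.map 2 (α 𝕜))
    (g := α 𝕜 ∘ₗ d₂ 𝕜 L) ?_ t
  ext v
  simp [d₂, map_bracket]

theorem map_α_wedge (x y : L) :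
    exteriorPower.map 2 (α 𝕜) (wedge 𝕜 x y) = wedge 𝕜 (α 𝕜 x) (α 𝕜 y) := by
  simp only [wedge, LinearMap.mk₂_apply, exteriorPower.map_apply_ιMulti]
  congr 1
  ext i
  fin_cases i <;> rfl

theorem map_α_d₃ (t : ⋀[𝕜]^3 L) : exteriorPower.map 2 (α 𝕜) (d₃ 𝕜 L t) =
    d₃ 𝕜 L (exteriorPower.map 3 (α 𝕜) t) := by
  refine LinearMap.congr_fun (f := exteriorPower.map 2 (α 𝕜) ∘ₗ d₃ 𝕜 L)
    (g := d₃ 𝕜 L ∘ₗ exteriorPower.map 3 (α 𝕜)) ?_ t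
  ext v
  simp [d₃, map_α_wedge, map_bracket]

/-- The second homology `ker d₂ / im d₃` of a Hom-Lie algebra with trivial coefficients. -/
abbrev H₂ : Type _ := SubQuotient (d₂ 𝕜 L) (d₃ 𝕜 L)

/-- The endomorphism of the second homology induced by `α ∧ α`. -/
noncomputable def H₂.α : H₂ 𝕜 L →ₗ[𝕜] H₂ 𝕜 L :=
  SubQuotient.map (d₂ 𝕜 L) (d₃ 𝕜 L) (exteriorPower.map 3 (HomLieAlgebra.α 𝕜))
    (exteriorPower.map 2 (HomLieAlgebra.α 𝕜)) (HomLieAlgebra.α 𝕜) (d₂_map_α 𝕜 L) (map_α_d₃ 𝕜 L)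

end Homology

end HomLieAlgebra

/-!
Both halves of Hopf's formula rest on the universal property of the free Hom-Lie algebra
(`HomLieAlgebra.Free.lift`).

A free presentation of `L` is the homomorphism from the free Hom-Lie algebra on the underlying
Hom-set of `L` that extends the identity map.

The formula itself comes from the vanishing of the second homology of a free Hom-Lie algebra `F`
(`HomLieAlgebra.IsFree.ker_d₂_le`). For any Hom-Lie algebra `L`, put `K = ⋀² L / im d₃` and let
`d : K → L` be the map `x ∧ y ↦ [x, y]`. The space `L × K` with the product
`[e, e'] = (0, π e ∧ π e')`, where `π (x, k) = x + d k`, is a Hom-Lie algebra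
(`HomLieAlgebra.Cover`), the Hom-Jacobi identity being exactly the vanishing of `im d₃` in `K`, and
`π` is a homomorphism onto `L` with the linear, `α`-equivariant section `x ↦ (x, 0)`. If `L` is
free, `π` therefore has a section `s` in the category of Hom-Lie algebras, and
`s (d k) = (0, k)` for all `k`, so `d` is injective.

Given a presentation `ρ : F → L` with kernel `R`, a linear section `σ` of `ρ` defines a map
`⋀² L → F`, `x ∧ y ↦ [σ x, σ y]`, which modulo `[F, R]` does not depend on `σ`. It sends `ker d₂`
onto `R ∩ [F, F]` modulo `[F, R]`. Its kernel is `im d₃`: it contains `im d₃` by the Hom-Jacobi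
identity in `F`, and it is contained in it because `ker d₂ = im d₃` over `F`, the elements of
`[F, R]` being images of elements of `⋀² F` that vanish in `⋀² L`.
-/

namespace HomLieAlgebra

/-! ### Naturality of the differentials -/

section Naturality

variable {𝕜 : Type*} [Field 𝕜] {F : Type*} [AddCommGroup F] [Module 𝕜 F] [HomLieAlgebra 𝕜 F]
  {L : Type*} [AddCommGroup L] [Module 𝕜 L] [HomLieAlgebra 𝕜 L]

theorem Hom.map_bracket (ρ : Hom 𝕜 F L) (x y : F) :
    ρ.toLinearMap (bracket 𝕜 x y) = bracket 𝕜 (ρ.toLinearMap x) (ρ.toLinearMap y) :=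
  ρ.map_bracket' x y

theorem Hom.map_α (ρ : Hom 𝕜 F L) (x : F) :
    ρ.toLinearMap (α 𝕜 x) = α 𝕜 (ρ.toLinearMap x) :=
  ρ.map_α' x

theorem map_wedge {M N : Type*} [AddCommGroup M] [Module 𝕜 M] [AddCommGroup N] [Module 𝕜 N]
    (f : M →ₗ[𝕜] N) (x y : M) :
    exteriorPower.map 2 f (wedge 𝕜 x y) = wedge 𝕜 (f x) (f y) := by
  simp only [wedge, LinearMap.mk₂_apply, exteriorPower.map_apply_ιMulti]
  congr 1
  ext i
  fin_cases i <;> rfl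

theorem wedge_hom_ext {M N : Type*} [AddCommGroup M] [Module 𝕜 M] [AddCommGroup N] [Module 𝕜 N]
    {f g : ⋀[𝕜]^2 M →ₗ[𝕜] N} (h : ∀ x y, f (wedge 𝕜 x y) = g (wedge 𝕜 x y)) : f = g := by
  ext v
  have hv : v = ![v 0, v 1] := by ext i; fin_cases i <;> rfl
  rw [hv]
  exact h (v 0) (v 1)

theorem Hom.map_d₂ (ρ : Hom 𝕜 F L) (t : ⋀[𝕜]^2 F) :
    ρ.toLinearMap (d₂ 𝕜 F t) = d₂ 𝕜 L (exteriorPower.map 2 ρ.toLinearMap t) := by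
  refine LinearMap.congr_fun (f := ρ.toLinearMap ∘ₗ d₂ 𝕜 F)
    (g := d₂ 𝕜 L ∘ₗ exteriorPower.map 2 ρ.toLinearMap) (wedge_hom_ext fun x y => ?_) t
  simp [d₂_wedge, map_wedge, ρ.map_bracket]

theorem Hom.map_d₃ (ρ : Hom 𝕜 F L) (t : ⋀[𝕜]^3 F) :
    exteriorPower.map 2 ρ.toLinearMap (d₃ 𝕜 F t) =
      d₃ 𝕜 L (exteriorPower.map 3 ρ.toLinearMap t) := by
  refine LinearMap.congr_fun (f := exteriorPower.map 2 ρ.toLinearMap ∘ₗ d₃ 𝕜 F)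
    (g := d₃ 𝕜 L ∘ₗ exteriorPower.map 3 ρ.toLinearMap) ?_ t
  ext v
  simp [d₃, map_wedge, ρ.map_bracket, ρ.map_α]

theorem bracket_mem_commutator {H K : Submodule 𝕜 F} {x y : F} (hx : x ∈ H) (hy : y ∈ K) :
    bracket 𝕜 x y ∈ commutator 𝕜 H K :=
  Submodule.subset_span ⟨x, hx, y, hy, rfl⟩

theorem range_d₂ : LinearMap.range (d₂ 𝕜 F) = commutator 𝕜 (⊤ : Submodule 𝕜 F) ⊤ := by
  apply le_antisymm
  · have h : (commutator 𝕜 (⊤ : Submodule 𝕜 F) ⊤).mkQ ∘ₗ d₂ 𝕜 F = 0 :=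
      wedge_hom_ext fun x y => by
        simp only [LinearMap.comp_apply, d₂_wedge, LinearMap.zero_apply, Submodule.mkQ_apply,
          Submodule.Quotient.mk_eq_zero]
        exact neg_mem (bracket_mem_commutator trivial trivial)
    rw [LinearMap.range_le_iff_comap, Submodule.eq_top_iff']
    intro t
    simpa using LinearMap.congr_fun h t
  · refine Submodule.span_le.2 ?_
    rintro _ ⟨x, -, y, -, rfl⟩
    exact ⟨-wedge 𝕜 x y, by rw [map_neg, d₂_wedge, neg_neg]⟩

end Naturality

/-! ### The universal property of free Hom-Lie algebras -/

section Lift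

variable {𝕜 : Type*} [Field 𝕜] {X : Type*} {αX : X → X}
  {M : Type*} [AddCommGroup M] [Module 𝕜 M] [HomLieAlgebra 𝕜 M]

variable (𝕜 M) in
/-- A Hom-Lie algebra as a non-associative ring. This is not an instance, since `𝕜` cannot be
inferred and `M` may carry another product. -/
abbrev toNonUnitalNonAssocRing : NonUnitalNonAssocRing M :=
  { ‹AddCommGroup M› with
    mul := fun x y => bracket 𝕜 x y
    left_distrib := fun x y z => map_add (bracket 𝕜 x) y z
    right_distrib := fun x y z => LinearMap.map_add₂ (bracket 𝕜) x y z
    zero_mul := fun x => LinearMap.map_zero₂ (bracket 𝕜) x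
    mul_zero := fun x => map_zero (bracket 𝕜 x) }

/-- A map of sets into a Hom-Lie algebra extends to the free non-associative algebra. -/
theorem exists_linearMap_of (f : X → M) :
    ∃ g : FreeNonUnitalNonAssocAlgebra 𝕜 X →ₗ[𝕜] M,
      (∀ a b, g (a * b) = bracket 𝕜 (g a) (g b)) ∧
        ∀ x, g (FreeNonUnitalNonAssocAlgebra.of 𝕜 x) = f x := by
  let _ := toNonUnitalNonAssocRing 𝕜 M
  have : IsScalarTower 𝕜 M M := ⟨fun c x y => LinearMap.map_smul₂ (bracket 𝕜) c x y⟩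
  have : SMulCommClass 𝕜 M M := ⟨fun c x y => (map_smul (bracket 𝕜 x) c y).symm⟩
  refine ⟨(FreeNonUnitalNonAssocAlgebra.lift 𝕜 f : _ →ₗ[𝕜] M), fun a b => ?_, fun x => ?_⟩
  · exact map_mul (FreeNonUnitalNonAssocAlgebra.lift 𝕜 f) a b
  · exact FreeNonUnitalNonAssocAlgebra.lift_of_apply 𝕜 f x

/-- Linear maps out of the free non-associative algebra that preserve products are determined by
their values on generators. -/
theorem linearMap_ext_of {g g' : FreeNonUnitalNonAssocAlgebra 𝕜 X →ₗ[𝕜] M}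
    (hg : ∀ a b, g (a * b) = bracket 𝕜 (g a) (g b))
    (hg' : ∀ a b, g' (a * b) = bracket 𝕜 (g' a) (g' b))
    (h : ∀ x, g (FreeNonUnitalNonAssocAlgebra.of 𝕜 x) =
      g' (FreeNonUnitalNonAssocAlgebra.of 𝕜 x)) : g = g' := by
  let _ := toNonUnitalNonAssocRing 𝕜 M
  have : IsScalarTower 𝕜 M M := ⟨fun c x y => LinearMap.map_smul₂ (bracket 𝕜) c x y⟩
  have : SMulCommClass 𝕜 M M := ⟨fun c x y => (map_smul (bracket 𝕜 x) c y).symm⟩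
  let G : FreeNonUnitalNonAssocAlgebra 𝕜 X →ₙₐ[𝕜] M :=
    { toFun := g, map_smul' := map_smul g, map_zero' := map_zero g, map_add' := map_add g,
      map_mul' := hg }
  let G' : FreeNonUnitalNonAssocAlgebra 𝕜 X →ₙₐ[𝕜] M :=
    { toFun := g', map_smul' := map_smul g', map_zero' := map_zero g', map_add' := map_add g',
      map_mul' := hg' }
  have hG : G = G' := FreeNonUnitalNonAssocAlgebra.hom_ext 𝕜 h
  exact LinearMap.ext fun a => DFunLike.congr_fun hG a

/-- A map of Hom-sets into a Hom-Lie algebra extends to the free Hom-Lie algebra. -/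
theorem Free.lift (f : X → M) (hf : ∀ x, f (αX x) = α 𝕜 (f x)) :
    ∃ g : Hom 𝕜 (Free 𝕜 αX) M, ∀ x,
      g.toLinearMap (Submodule.Quotient.mk (FreeNonUnitalNonAssocAlgebra.of 𝕜 x)) = f x := by
  obtain ⟨g, hmul, hof⟩ := exists_linearMap_of (𝕜 := 𝕜) f
  have hα : ∀ a, g (freeα 𝕜 αX a) = α 𝕜 (g a) := by
    -- `x ↦ f (αX x)` extends to both sides
    refine LinearMap.congr_fun (f := g ∘ₗ (freeα 𝕜 αX : _ →ₗ[𝕜] _)) (g := α 𝕜 ∘ₗ g)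
      (linearMap_ext_of (fun a b => ?_) (fun a b => ?_) fun x => ?_)
    · simp [hmul]
    · simp [hmul, HomLieAlgebra.map_bracket]
    · simp [freeα, hof, hf]
  have hker : freeIdeal 𝕜 αX ≤ LinearMap.ker g := by
    refine freeIdeal_le 𝕜 αX ⟨fun a => ?_, fun a b => ?_, fun a b c => ?_, fun a x hx => ?_,
      fun a x hx => ?_⟩
    · simp [hmul, bracket_self]
    · simp [hmul, bracket_skew 𝕜 (g a) (g b)]
    · simp [hmul, hα, hom_jacobi]
    · rw [LinearMap.mem_ker] at hx ⊢
      rw [hmul, hx, map_zero]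
    · rw [LinearMap.mem_ker] at hx ⊢
      rw [hmul, hx, LinearMap.map_zero₂]
  refine ⟨{ (freeIdeal 𝕜 αX).liftQ g hker with map_bracket' := ?_, map_α' := ?_ }, hof⟩
  · intro x y
    obtain ⟨a, rfl⟩ := Submodule.Quotient.mk_surjective _ x
    obtain ⟨b, rfl⟩ := Submodule.Quotient.mk_surjective _ y
    exact hmul a b
  · intro x
    obtain ⟨a, rfl⟩ := Submodule.Quotient.mk_surjective _ x
    exact hα a

theorem Free.hom_ext {g g' : Hom 𝕜 (Free 𝕜 αX) M}
    (h : ∀ x, g.toLinearMap (Submodule.Quotient.mk (FreeNonUnitalNonAssocAlgebra.of 𝕜 x)) =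
      g'.toLinearMap (Submodule.Quotient.mk (FreeNonUnitalNonAssocAlgebra.of 𝕜 x))) :
    g.toLinearMap = g'.toLinearMap := by
  refine Submodule.linearMap_qext _ (linearMap_ext_of (fun a b => ?_) (fun a b => ?_) h)
  · exact g.map_bracket (Submodule.Quotient.mk a) (Submodule.Quotient.mk b)
  · exact g'.map_bracket (Submodule.Quotient.mk a) (Submodule.Quotient.mk b)

/-- Free Hom-Lie algebras are projective relative to the homomorphisms that split as maps of
Hom-vector spaces. The section `σ` has to commute with `α`, so that it carries the generators to a
Hom-set. -/
theorem IsFree.exists_section {F : Type*} [AddCommGroup F] [Module 𝕜 F] [HomLieAlgebra 𝕜 F]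
    (hF : IsFree 𝕜 F) (π : Hom 𝕜 M F) (σ : F →ₗ[𝕜] M) (hσ : ∀ x, π.toLinearMap (σ x) = x)
    (hσα : ∀ x, σ (α 𝕜 x) = α 𝕜 (σ x)) :
    ∃ s : F →ₗ[𝕜] M, (∀ x y, s (bracket 𝕜 x y) = bracket 𝕜 (s x) (s y)) ∧
      ∀ x, π.toLinearMap (s x) = x := by
  obtain ⟨X, αX, e, he⟩ := hF
  have hα : ∀ x, α 𝕜 (Submodule.Quotient.mk (FreeNonUnitalNonAssocAlgebra.of 𝕜 x) : Free 𝕜 αX) =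
      Submodule.Quotient.mk (FreeNonUnitalNonAssocAlgebra.of 𝕜 (αX x)) := fun x =>
    congrArg Submodule.Quotient.mk (FreeNonUnitalNonAssocAlgebra.lift_of_apply 𝕜 _ x)
  obtain ⟨g, hg⟩ := Free.lift (𝕜 := 𝕜) (αX := αX)
    (fun x => σ (e.toLinearMap (Submodule.Quotient.mk (FreeNonUnitalNonAssocAlgebra.of 𝕜 x))))
    (fun x => by rw [← hα, e.map_α, hσα])
  let πg : Hom 𝕜 (Free 𝕜 αX) F :=
    { π.toLinearMap ∘ₗ g.toLinearMap with
      map_bracket' := fun x y => by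
        change π.toLinearMap (g.toLinearMap _) = _
        rw [g.map_bracket, π.map_bracket]; rfl
      map_α' := fun x => by
        change π.toLinearMap (g.toLinearMap _) = _
        rw [g.map_α, π.map_α]; rfl }
  have hπg : ∀ x, π.toLinearMap (g.toLinearMap x) = e.toLinearMap x :=
    LinearMap.congr_fun (Free.hom_ext (g := πg) (g' := e) fun x => by
      change π.toLinearMap (g.toLinearMap _) = _
      rw [hg, hσ])
  let E := LinearEquiv.ofBijective e.toLinearMap he
  have hE : ∀ x, e.toLinearMap (E.symm x) = x := E.apply_symm_apply
  refine ⟨g.toLinearMap ∘ₗ E.symm.toLinearMap, fun x y => ?_, fun x => ?_⟩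
  · have h : E.symm (bracket 𝕜 x y) = bracket 𝕜 (E.symm x) (E.symm y) := by
      apply he.injective
      rw [e.map_bracket, hE, hE, hE]
    simp [h, g.map_bracket]
  · simp [hπg, hE]

end Lift

/-! ### Vanishing of the second homology of free Hom-Lie algebras -/

section Cover

variable (𝕜 : Type*) [Field 𝕜] (L : Type*) [AddCommGroup L] [Module 𝕜 L] [HomLieAlgebra 𝕜 L]

/-- The exterior square `⋀² L / im d₃`, which maps onto `[L, L]` with kernel the second homology
of `L`. -/
abbrev ExteriorSquare : Type _ := ⋀[𝕜]^2 L ⧸ LinearMap.range (d₃ 𝕜 L)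

/-- The map `x ∧ y ↦ [x, y]` from the exterior square to `L`. -/
noncomputable def ExteriorSquare.toAlgebra : ExteriorSquare 𝕜 L →ₗ[𝕜] L :=
  (LinearMap.range (d₃ 𝕜 L)).liftQ (-d₂ 𝕜 L) (by
    rintro _ ⟨s, rfl⟩
    have h := LinearMap.congr_fun (d₂_comp_d₃ 𝕜 L) s
    rw [LinearMap.comp_apply, LinearMap.zero_apply] at h
    rw [LinearMap.mem_ker, LinearMap.neg_apply, h, neg_zero])

/-- The endomorphism of the exterior square induced by `α ∧ α`. -/
noncomputable def ExteriorSquare.map : ExteriorSquare 𝕜 L →ₗ[𝕜] ExteriorSquare 𝕜 L :=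
  Submodule.mapQ _ _ (exteriorPower.map 2 (α 𝕜)) (by
    rintro _ ⟨s, rfl⟩
    exact ⟨_, (map_α_d₃ 𝕜 L s).symm⟩)

variable {L} in
/-- The class of `x ∧ y` in the exterior square. -/
noncomputable def starWedge : L →ₗ[𝕜] L →ₗ[𝕜] ExteriorSquare 𝕜 L :=
  (wedge 𝕜).compr₂ (LinearMap.range (d₃ 𝕜 L)).mkQ

variable {L}

theorem starWedge_apply (x y : L) :
    starWedge 𝕜 x y = Submodule.Quotient.mk (wedge 𝕜 x y) := rfl

theorem starWedge_skew (x y : L) : starWedge 𝕜 x y = -starWedge 𝕜 y x := by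
  rw [starWedge_apply, starWedge_apply, wedge_skew, Submodule.Quotient.mk_neg]

theorem starWedge_jacobi (x y z : L) :
    starWedge 𝕜 (α 𝕜 x) (bracket 𝕜 y z) + starWedge 𝕜 (α 𝕜 y) (bracket 𝕜 z x) +
      starWedge 𝕜 (α 𝕜 z) (bracket 𝕜 x y) = 0 := by
  have h : (LinearMap.range (d₃ 𝕜 L)).mkQ (d₃ 𝕜 L (exteriorPower.ιMulti 𝕜 3 ![x, y, z])) = 0 :=
    (Submodule.Quotient.mk_eq_zero _).2 ⟨_, rfl⟩
  rw [d₃_ιMulti, map_sub, map_add, map_neg] at h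
  change -starWedge 𝕜 _ _ + starWedge 𝕜 _ _ - starWedge 𝕜 _ _ = 0 at h
  rw [starWedge_skew 𝕜 (α 𝕜 x), starWedge_skew 𝕜 (α 𝕜 y), starWedge_skew 𝕜 (α 𝕜 z),
    bracket_skew 𝕜 z x, map_neg, LinearMap.neg_apply, neg_neg, ← h]
  abel

theorem toAlgebra_starWedge (x y : L) :
    ExteriorSquare.toAlgebra 𝕜 L (starWedge 𝕜 x y) = bracket 𝕜 x y := by
  change -d₂ 𝕜 L (wedge 𝕜 x y) = _
  rw [d₂_wedge, neg_neg]

theorem toAlgebra_map (k : ExteriorSquare 𝕜 L) :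
    ExteriorSquare.toAlgebra 𝕜 L (ExteriorSquare.map 𝕜 L k) =
      α 𝕜 (ExteriorSquare.toAlgebra 𝕜 L k) := by
  obtain ⟨t, rfl⟩ := Submodule.Quotient.mk_surjective _ k
  change -d₂ 𝕜 L (exteriorPower.map 2 (α 𝕜) t) = α 𝕜 (-d₂ 𝕜 L t)
  rw [d₂_map_α, map_neg]

theorem map_starWedge (x y : L) :
    ExteriorSquare.map 𝕜 L (starWedge 𝕜 x y) = starWedge 𝕜 (α 𝕜 x) (α 𝕜 y) :=
  congrArg Submodule.Quotient.mk (map_α_wedge 𝕜 L x y)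

variable (L)

/-- The space `L × (⋀² L / im d₃)`, which is mapped onto `L` by `Cover.proj` and whose product
is `[e, e'] = (0, proj e ∧ proj e')`. -/
def Cover : Type _ := L × ExteriorSquare 𝕜 L

noncomputable instance : AddCommGroup (Cover 𝕜 L) :=
  inferInstanceAs (AddCommGroup (L × ExteriorSquare 𝕜 L))

noncomputable instance : Module 𝕜 (Cover 𝕜 L) :=
  inferInstanceAs (Module 𝕜 (L × ExteriorSquare 𝕜 L))

/-- The projection `(x, k) ↦ x + d k`, where `d (x ∧ y) = [x, y]`. -/
noncomputable def Cover.proj : Cover 𝕜 L →ₗ[𝕜] L :=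
  LinearMap.coprod LinearMap.id (ExteriorSquare.toAlgebra 𝕜 L)

/-- The inclusion of the exterior square. -/
noncomputable def Cover.inr : ExteriorSquare 𝕜 L →ₗ[𝕜] Cover 𝕜 L :=
  LinearMap.inr 𝕜 L (ExteriorSquare 𝕜 L)

theorem Cover.inr_injective : Function.Injective (Cover.inr 𝕜 L) :=
  LinearMap.inr_injective

/-- The companion endomorphism `(x, k) ↦ (α x, (α ∧ α) k)`. -/
noncomputable def Cover.map : Cover 𝕜 L →ₗ[𝕜] Cover 𝕜 L :=
  LinearMap.prodMap (HomLieAlgebra.α 𝕜) (ExteriorSquare.map 𝕜 L)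

variable {L}

theorem Cover.proj_inr (k : ExteriorSquare 𝕜 L) :
    Cover.proj 𝕜 L (Cover.inr 𝕜 L k) = ExteriorSquare.toAlgebra 𝕜 L k :=
  zero_add _

theorem Cover.map_inr (k : ExteriorSquare 𝕜 L) :
    Cover.map 𝕜 L (Cover.inr 𝕜 L k) = Cover.inr 𝕜 L (ExteriorSquare.map 𝕜 L k) :=
  Prod.ext (map_zero (HomLieAlgebra.α (L := L) 𝕜)) rfl

theorem Cover.proj_map (e : Cover 𝕜 L) :
    Cover.proj 𝕜 L (Cover.map 𝕜 L e) = HomLieAlgebra.α 𝕜 (Cover.proj 𝕜 L e) := by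
  change HomLieAlgebra.α 𝕜 e.1 + ExteriorSquare.toAlgebra 𝕜 L (ExteriorSquare.map 𝕜 L e.2) =
    HomLieAlgebra.α 𝕜 (e.1 + ExteriorSquare.toAlgebra 𝕜 L e.2)
  rw [map_add, toAlgebra_map]

noncomputable instance : HomLieAlgebra 𝕜 (Cover 𝕜 L) where
  bracket := ((starWedge 𝕜).compl₁₂ (Cover.proj 𝕜 L) (Cover.proj 𝕜 L)).compr₂ (Cover.inr 𝕜 L)
  α := Cover.map 𝕜 L
  bracket_self e := by
    simp [starWedge_apply, wedge_self]
  hom_jacobi e e' e'' := by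
    simp only [LinearMap.compr₂_apply, LinearMap.compl₁₂_apply, Cover.proj_inr,
      toAlgebra_starWedge, Cover.proj_map, ← map_add, starWedge_jacobi, map_zero]
  map_bracket e e' := by
    simp only [LinearMap.compr₂_apply, LinearMap.compl₁₂_apply, Cover.map_inr, Cover.proj_map,
      map_starWedge]

theorem Cover.bracket_eq (e e' : Cover 𝕜 L) :
    bracket 𝕜 e e' = Cover.inr 𝕜 L (starWedge 𝕜 (Cover.proj 𝕜 L e) (Cover.proj 𝕜 L e')) := rfl

variable (L) in
/-- The projection of the cover as a homomorphism of Hom-Lie algebras. -/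
noncomputable def Cover.projHom : Hom 𝕜 (Cover 𝕜 L) L :=
  { Cover.proj 𝕜 L with
    map_bracket' := fun e e' => by
      change Cover.proj 𝕜 L _ = bracket 𝕜 (Cover.proj 𝕜 L e) (Cover.proj 𝕜 L e')
      rw [Cover.bracket_eq, Cover.proj_inr, toAlgebra_starWedge]
    map_α' := Cover.proj_map 𝕜 }

/-- The second homology of a free Hom-Lie algebra vanishes. -/
theorem IsFree.ker_d₂_le (hL : IsFree 𝕜 L) :
    LinearMap.ker (d₂ 𝕜 L) ≤ LinearMap.range (d₃ 𝕜 L) := by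
  obtain ⟨s, hs, hπ⟩ := hL.exists_section (Cover.projHom 𝕜 L)
    (LinearMap.inl 𝕜 L (ExteriorSquare 𝕜 L))
    (fun x => (congrArg (x + ·) (map_zero (ExteriorSquare.toAlgebra 𝕜 L))).trans
      (add_zero x))
    (fun x => Prod.ext rfl (map_zero (ExteriorSquare.map 𝕜 L)).symm)
  replace hπ : ∀ x, Cover.proj 𝕜 L (s x) = x := hπ
  -- on `x ∧ y`, both sides are `[s x, s y]`
  have key : -(s ∘ₗ d₂ 𝕜 L) = Cover.inr 𝕜 L ∘ₗ (LinearMap.range (d₃ 𝕜 L)).mkQ :=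
    wedge_hom_ext fun x y => by
      rw [LinearMap.neg_apply, LinearMap.comp_apply, d₂_wedge, map_neg, neg_neg, hs,
        Cover.bracket_eq, hπ, hπ]
      rfl
  intro t ht
  rw [LinearMap.mem_ker] at ht
  have h := LinearMap.congr_fun key t
  rw [LinearMap.neg_apply, LinearMap.comp_apply, ht, map_zero, neg_zero, LinearMap.comp_apply,
    ← map_zero (Cover.inr 𝕜 L)] at h
  exact (Submodule.Quotient.mk_eq_zero _).1 (Cover.inr_injective 𝕜 L h).symm

end Cover

/-! ### Hopf's formula -/

section Hopf

variable {𝕜 : Type*} [Field 𝕜] {F : Type*} [AddCommGroup F] [Module 𝕜 F] [HomLieAlgebra 𝕜 F]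
  {L : Type*} [AddCommGroup L] [Module 𝕜 L] [HomLieAlgebra 𝕜 L] {ρ : Hom 𝕜 F L}
  {σ : L →ₗ[𝕜] F}

theorem map_map_of_section (hσ : ρ.toLinearMap ∘ₗ σ = LinearMap.id) (t : ⋀[𝕜]^2 L) :
    exteriorPower.map 2 ρ.toLinearMap (exteriorPower.map 2 σ t) = t := by
  rw [← LinearMap.comp_apply, ← exteriorPower.map_comp, hσ, exteriorPower.map_id,
    LinearMap.id_apply]

theorem d₂_sub_mem (hσ : ρ.toLinearMap ∘ₗ σ = LinearMap.id) (u : ⋀[𝕜]^2 F) :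
    d₂ 𝕜 F u - d₂ 𝕜 F (exteriorPower.map 2 σ (exteriorPower.map 2 ρ.toLinearMap u)) ∈
      commutator 𝕜 ⊤ ρ.ker := by
  have h : (commutator 𝕜 ⊤ ρ.ker).mkQ ∘ₗ d₂ 𝕜 F = (commutator 𝕜 ⊤ ρ.ker).mkQ ∘ₗ d₂ 𝕜 F ∘ₗ
      exteriorPower.map 2 σ ∘ₗ exteriorPower.map 2 ρ.toLinearMap := by
    refine wedge_hom_ext fun x y => ?_
    have hmem : ∀ z, z - σ (ρ.toLinearMap z) ∈ ρ.ker := fun z => by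
      rw [Hom.mem_ker, map_sub, ← LinearMap.comp_apply, hσ, LinearMap.id_apply, sub_self]
    simp only [LinearMap.comp_apply, map_wedge, d₂_wedge, Submodule.mkQ_apply]
    rw [Submodule.Quotient.eq]
    -- `[x', y'] - [x, y] = [y, x - x'] - [x', y - y']` where `x' = σ (ρ x)`, `y' = σ (ρ y)`
    have h1 := bracket_mem_commutator (𝕜 := 𝕜) (Submodule.mem_top (x := y)) (hmem x)
    have h2 := bracket_mem_commutator (𝕜 := 𝕜) (Submodule.mem_top (x := σ (ρ.toLinearMap x)))
      (hmem y)
    convert sub_mem h1 h2 using 1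
    rw [map_sub, map_sub, bracket_skew 𝕜 y x, bracket_skew 𝕜 y]
    abel
  rw [← Submodule.Quotient.eq]
  exact LinearMap.congr_fun h u

/-- Elements of `⋀² F` that vanish in `⋀² L` have their differential in `[F, R]`. -/
theorem d₂_mem_commutator_ker (hσ : ρ.toLinearMap ∘ₗ σ = LinearMap.id) {u : ⋀[𝕜]^2 F}
    (hu : exteriorPower.map 2 ρ.toLinearMap u = 0) : d₂ 𝕜 F u ∈ commutator 𝕜 ⊤ ρ.ker := by
  simpa [hu] using d₂_sub_mem hσ u

theorem exists_d₂_eq_of_mem_commutator_ker {y : F} (hy : y ∈ commutator 𝕜 ⊤ ρ.ker) :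
    ∃ u, exteriorPower.map 2 ρ.toLinearMap u = 0 ∧ d₂ 𝕜 F u = y := by
  suffices h : commutator 𝕜 ⊤ ρ.ker ≤
      (LinearMap.ker (exteriorPower.map 2 ρ.toLinearMap)).map (d₂ 𝕜 F) from h hy
  refine Submodule.span_le.2 ?_
  rintro _ ⟨x, -, r, hr, rfl⟩
  refine ⟨-wedge 𝕜 x r, ?_, by rw [map_neg, d₂_wedge, neg_neg]⟩
  rw [Hom.mem_ker] at hr
  change exteriorPower.map 2 ρ.toLinearMap _ = 0
  rw [map_neg, map_wedge, hr, map_zero, neg_zero]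

/-- The map `x ∧ y ↦ [σ x, σ y]` from `ker d₂` to `R ∩ [F, F]`. -/
noncomputable def hopfMap (hσ : ρ.toLinearMap ∘ₗ σ = LinearMap.id) :
    LinearMap.ker (d₂ 𝕜 L) →ₗ[𝕜] ρ.kerInfCommutator :=
  ((-d₂ 𝕜 F ∘ₗ exteriorPower.map 2 σ).domRestrict _).codRestrict _ (fun t => by
    refine ⟨?_, ?_⟩
    · change ρ.toLinearMap (-d₂ 𝕜 F (exteriorPower.map 2 σ t.1)) = 0
      rw [map_neg, ρ.map_d₂, map_map_of_section hσ, LinearMap.mem_ker.1 t.2, neg_zero]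
    · rw [← range_d₂]
      exact neg_mem ⟨_, rfl⟩)

theorem coe_hopfMap (hσ : ρ.toLinearMap ∘ₗ σ = LinearMap.id) (t : LinearMap.ker (d₂ 𝕜 L)) :
    (hopfMap hσ t : F) = -d₂ 𝕜 F (exteriorPower.map 2 σ t.1) := rfl

/-- The map induced by `hopfMap` from `ker d₂` to the Schur multiplier. -/
noncomputable def hopfMapQ (hσ : ρ.toLinearMap ∘ₗ σ = LinearMap.id) :
    LinearMap.ker (d₂ 𝕜 L) →ₗ[𝕜] SchurMultiplier ρ :=
  Submodule.mkQ _ ∘ₗ hopfMap hσ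

theorem hopfMapQ_surjective (hσ : ρ.toLinearMap ∘ₗ σ = LinearMap.id) :
    Function.Surjective (hopfMapQ hσ) := by
  intro q
  obtain ⟨⟨y, hy⟩, rfl⟩ := Submodule.Quotient.mk_surjective _ q
  have hy' := hy.2
  rw [← range_d₂] at hy'
  obtain ⟨u, rfl⟩ := hy'
  have hu : -exteriorPower.map 2 ρ.toLinearMap u ∈ LinearMap.ker (d₂ 𝕜 L) := by
    rw [LinearMap.mem_ker, map_neg, ← ρ.map_d₂, ρ.mem_ker.1 hy.1, neg_zero]
  refine ⟨⟨_, hu⟩, (Submodule.Quotient.eq _).2 ?_⟩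
  rw [Submodule.submoduleOf, Submodule.mem_comap]
  have h := neg_mem (d₂_sub_mem hσ u)
  rw [neg_sub] at h
  simpa [coe_hopfMap] using h

theorem ker_hopfMapQ (hσ : ρ.toLinearMap ∘ₗ σ = LinearMap.id) (hF : IsFree 𝕜 F) :
    LinearMap.ker (hopfMapQ hσ) =
      (LinearMap.range (d₃ 𝕜 L)).submoduleOf (LinearMap.ker (d₂ 𝕜 L)) := by
  ext t
  have h0 : t ∈ LinearMap.ker (hopfMapQ hσ) ↔
      d₂ 𝕜 F (exteriorPower.map 2 σ t.1) ∈ commutator 𝕜 ⊤ ρ.ker := by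
    rw [← neg_mem_iff (x := d₂ 𝕜 F _), ← coe_hopfMap hσ]
    exact Submodule.Quotient.mk_eq_zero _
  rw [h0, Submodule.submoduleOf, Submodule.mem_comap]
  constructor
  · intro h
    obtain ⟨v, hv, hvd⟩ := exists_d₂_eq_of_mem_commutator_ker h
    obtain ⟨w, hw⟩ := IsFree.ker_d₂_le 𝕜 hF
      (show exteriorPower.map 2 σ t.1 - v ∈ LinearMap.ker (d₂ 𝕜 F) by
        rw [LinearMap.mem_ker, map_sub, hvd, sub_self])
    refine ⟨exteriorPower.map 3 ρ.toLinearMap w, ?_⟩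
    rw [← ρ.map_d₃, hw, map_sub, hv, sub_zero, map_map_of_section hσ]
    rfl
  · rintro ⟨s, hs⟩
    replace hs : d₃ 𝕜 L s = t.1 := hs
    -- `σ ∧ σ` does not commute with `d₃`, but the defect vanishes in `⋀² L`
    have hd : d₂ 𝕜 F (d₃ 𝕜 F (exteriorPower.map 3 σ s)) = 0 :=
      LinearMap.congr_fun (d₂_comp_d₃ 𝕜 F) _
    have h := d₂_mem_commutator_ker hσ
      (u := exteriorPower.map 2 σ t.1 - d₃ 𝕜 F (exteriorPower.map 3 σ s)) (by
        rw [map_sub, map_map_of_section hσ, ρ.map_d₃, ← LinearMap.comp_apply (exteriorPower.map 3 _),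
          ← exteriorPower.map_comp, hσ, exteriorPower.map_id, LinearMap.id_apply, hs, sub_self])
    rwa [map_sub, hd, sub_zero] at h

/-- The isomorphism of Hopf's formula, as a map of vector spaces. -/
noncomputable def hopfEquiv (hσ : ρ.toLinearMap ∘ₗ σ = LinearMap.id) (hF : IsFree 𝕜 F) :
    H₂ 𝕜 L ≃ₗ[𝕜] SchurMultiplier ρ :=
  (Submodule.quotEquivOfEq _ _ (ker_hopfMapQ hσ hF).symm).trans
    ((hopfMapQ hσ).quotKerEquivOfSurjective (hopfMapQ_surjective hσ))

theorem hopfEquiv_α (hσ : ρ.toLinearMap ∘ₗ σ = LinearMap.id) (hF : IsFree 𝕜 F) (z : H₂ 𝕜 L) :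
    hopfEquiv hσ hF (H₂.α 𝕜 L z) = SchurMultiplier.α ρ (hopfEquiv hσ hF z) := by
  obtain ⟨t, rfl⟩ := Submodule.Quotient.mk_surjective _ z
  refine (Submodule.Quotient.eq _).2 ?_
  change -d₂ 𝕜 F (exteriorPower.map 2 σ (exteriorPower.map 2 (α 𝕜) t.1)) -
    α 𝕜 (-d₂ 𝕜 F (exteriorPower.map 2 σ t.1)) ∈ commutator 𝕜 ⊤ ρ.ker
  rw [map_neg, ← d₂_map_α, sub_neg_eq_add, ← map_neg, ← map_add]
  -- `σ` need not commute with `α`, but the defect vanishes in `⋀² L`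
  apply d₂_mem_commutator_ker hσ
  have hρα : ρ.toLinearMap ∘ₗ α 𝕜 = α 𝕜 ∘ₗ ρ.toLinearMap := LinearMap.ext ρ.map_α
  rw [map_add, map_neg, map_map_of_section hσ,
    ← LinearMap.comp_apply (exteriorPower.map 2 ρ.toLinearMap), ← exteriorPower.map_comp, hρα,
    exteriorPower.map_comp, LinearMap.comp_apply, map_map_of_section hσ, neg_add_cancel]

end Hopf

end HomLieAlgebra

theorem corollary4p5 {𝕜 : Type u} [Field 𝕜] {L : Type v} [AddCommGroup L] [Module 𝕜 L]
    [HomLieAlgebra 𝕜 L] :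
    -- `L` has a free presentation
    (∃ (X : Type v) (αX : X → X) (ρ : HomLieAlgebra.Hom 𝕜 (HomLieAlgebra.Free 𝕜 αX) L),
      Function.Surjective ρ.toLinearMap) ∧
    -- and for every free presentation, Hopf's formula holds
    ∀ (F : Type w) [AddCommGroup F] [Module 𝕜 F] [HomLieAlgebra 𝕜 F]
      (_ : HomLieAlgebra.IsFree.{u, w, x} 𝕜 F)
      (ρ : HomLieAlgebra.Hom 𝕜 F L) (_ : Function.Surjective ρ.toLinearMap),
      ∃ e : HomLieAlgebra.H₂ 𝕜 L ≃ₗ[𝕜] HomLieAlgebra.SchurMultiplier ρ,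
        ∀ z, e (HomLieAlgebra.H₂.α 𝕜 L z) = HomLieAlgebra.SchurMultiplier.α ρ (e z) := by
  refine ⟨?_, fun F _ _ _ hF ρ hρ => ?_⟩
  · obtain ⟨g, hg⟩ := HomLieAlgebra.Free.lift (𝕜 := 𝕜) (αX := HomLieAlgebra.α (L := L) 𝕜)
      (id : L → L) (fun _ => rfl)
    exact ⟨L, _, g, fun x => ⟨_, hg x⟩⟩
  · obtain ⟨σ, hσ⟩ := ρ.toLinearMap.exists_rightInverse_of_surjective (LinearMap.range_eq_top.2 hρ)
    exact ⟨HomLieAlgebra.hopfEquiv hσ hF, HomLieAlgebra.hopfEquiv_α hσ hF⟩
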